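/- Let $N\ge 1$ and let $X$ be the set of real-valued $u\in W^{1,2}(\mathbb R^N)$ with $\|xu\|_2<\infty$. For $u\in X$ put $$\delta_2(u)=\Big(\int_{\mathbb R^N}|\nabla u|^2\,dx\Big)\Big(\int_{\mathbb R^N}|x|^2|u|^2\,dx\Big)-\frac{N^2}{4}\Big(\int_{\mathbb R^N}|u|^2\,dx\Big)^2,$$ where $\nabla u$ is the weak gradient. Let $E=\{c\,e^{-\alpha|x|^2}: c\in\mathbb R,\ \alpha>0\}$, and let $$d_1(u,E)=\inf\{\|u-v\|_2: v\in E\},\qquad d_2(u,E)=\inf\{\|u-v\|_2: v\in E,\ \|v\|_2=\|u\|_2\}.$$ Then for all $u\in X$ $$\delta_2(u)\ \ge\ N\Big(\int_{\mathbb R^N}|u|^2\,dx\Big)d_1(u,E)^2+d_1(u,E)^4\tag{1}$$ and $$\delta_2(u)\ \ge\ \frac N2\Big(\int_{\mathbb R^N}|u|^2\,dx\Big)d_2(u,E)^2+\frac14\,d_2(u,E)^4.\tag{2}$$ Both inequalities are sharp: in (1) neither of the constants $N$ and $1$, and in (2) neither of the constants $\frac N2$ and $\frac14$, can be replaced by a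 larger one while the other is kept, if the inequality is to hold for all $u\in X$. Moreover, equality is attained nontrivially: there is $u\in X$ with $d_1(u,E)>0$ and equality in (1), and there is $u\in X$ with $d_1(u,E)>0$, $d_2(u,E)>0$ and equality in (2). -/

import Mathlib

open MeasureTheory
open scoped ContDiff

namespace Heisenberg

/-- `G` is a weak (distributional) gradient of `u` on `ℝ^N`: both are locally integrable and
`∫ u ∂ᵢφ = - ∫ Gᵢ φ` for every test function `φ ∈ C_c^∞(ℝ^N)` and every coordinate `i`. -/
structure HasWeakGradient {N : ℕ} (u : EuclideanSpace ℝ (Fin N) → ℝ)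
    (G : EuclideanSpace ℝ (Fin N) → EuclideanSpace ℝ (Fin N)) : Prop where
  locallyIntegrable : LocallyIntegrable u volume
  locallyIntegrable_grad : LocallyIntegrable G volume
  integral_eq : ∀ φ : EuclideanSpace ℝ (Fin N) → ℝ, ContDiff ℝ ∞ φ → HasCompactSupport φ →
    ∀ i : Fin N,
      ∫ x, u x * fderiv ℝ φ x (EuclideanSpace.single i (1 : ℝ)) = - ∫ x, G x i * φ x

open Classical in
/-- The weak gradient `∇u`, unique up to null sets (`HasWeakGradient.ae_eq` below); it is `0` by
convention if `u` has no weak gradient. -/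
noncomputable def weakGradient {N : ℕ} (u : EuclideanSpace ℝ (Fin N) → ℝ) :
    EuclideanSpace ℝ (Fin N) → EuclideanSpace ℝ (Fin N) :=
  if h : ∃ G, HasWeakGradient u G then h.choose else 0

/-- The space `{u ∈ W^{1,2}(ℝ^N) : ‖xu‖₂ < ∞}` of real-valued functions. -/
structure MemX {N : ℕ} (u : EuclideanSpace ℝ (Fin N) → ℝ) : Prop where
  memLp : MemLp u 2 volume
  exists_grad : ∃ G, HasWeakGradient u G ∧ MemLp G 2 volume
  memLp_weight : MemLp (fun x => ‖x‖ * u x) 2 volume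

/-- The `L²(ℝ^N)` norm `(∫ |f|²)^{1/2}`. -/
noncomputable def l2norm {N : ℕ} (f : EuclideanSpace ℝ (Fin N) → ℝ) : ℝ :=
  Real.sqrt (∫ x, |f x| ^ 2)

/-- The Heisenberg deficit
`δ₂(u) = (∫ |∇u|²) (∫ |x|² |u|²) - (N² / 4) (∫ |u|²)²`. -/
noncomputable def deficit {N : ℕ} (u : EuclideanSpace ℝ (Fin N) → ℝ) : ℝ :=
  (∫ x, ‖weakGradient u x‖ ^ 2) * (∫ x, ‖x‖ ^ 2 * |u x| ^ 2)
    - (N : ℝ) ^ 2 / 4 * (∫ x, |u x| ^ 2) ^ 2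

/-- The set `E = {c e^{-α|x|²} : c ∈ ℝ, α > 0}` of Gaussian functions on `ℝ^N`. -/
def gaussians (N : ℕ) : Set (EuclideanSpace ℝ (Fin N) → ℝ) :=
  {v | ∃ c α : ℝ, 0 < α ∧ v = fun x => c * Real.exp (-α * ‖x‖ ^ 2)}

/-- `d₁(u, E)`, the `L²` distance from `u` to the Gaussian functions. -/
noncomputable def dist₁ {N : ℕ} (u : EuclideanSpace ℝ (Fin N) → ℝ) : ℝ :=
  sInf {r : ℝ | ∃ v ∈ gaussians N, r = l2norm (fun x => u x - v x)}

/-- `d₂(u, E)`, the `L²` distance from `u` to the Gaussian functions of the same `L²` norm. -/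
noncomputable def dist₂ {N : ℕ} (u : EuclideanSpace ℝ (Fin N) → ℝ) : ℝ :=
  sInf {r : ℝ | ∃ v ∈ gaussians N, l2norm u = l2norm v ∧ r = l2norm (fun x => u x - v x)}

/-- Two weak gradients of the same function agree almost everywhere. -/
theorem HasWeakGradient.ae_eq {N : ℕ} {u : EuclideanSpace ℝ (Fin N) → ℝ}
    {G H : EuclideanSpace ℝ (Fin N) → EuclideanSpace ℝ (Fin N)}
    (hG : HasWeakGradient u G) (hH : HasWeakGradient u H) : G =ᵐ[volume] H := by
  have coord : ∀ (F : EuclideanSpace ℝ (Fin N) → EuclideanSpace ℝ (Fin N)) (i : Fin N),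
      LocallyIntegrable F volume → LocallyIntegrable (fun x => F x i) volume := by
    intro F i hF x
    obtain ⟨s, hs, hI⟩ := hF x
    exact ⟨s, hs, (EuclideanSpace.proj (𝕜 := ℝ) i).integrable_comp hI⟩
  have key : ∀ i : Fin N, ∀ᵐ x, G x i = H x i := by
    intro i
    refine ae_eq_of_integral_contDiff_smul_eq (coord G i hG.locallyIntegrable_grad)
      (coord H i hH.locallyIntegrable_grad) ?_
    intro φ hφ hc
    have h := (hG.integral_eq φ hφ hc i).symm.trans (hH.integral_eq φ hφ hc i)
    simpa [mul_comm] using h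
  filter_upwards [ae_all_iff.2 key] with x hx
  ext i
  exact hx i

theorem HasWeakGradient.weakGradient_ae_eq {N : ℕ} {u : EuclideanSpace ℝ (Fin N) → ℝ}
    {G : EuclideanSpace ℝ (Fin N) → EuclideanSpace ℝ (Fin N)} (hG : HasWeakGradient u G) :
    weakGradient u =ᵐ[volume] G := by
  have h : ∃ G, HasWeakGradient u G := ⟨G, hG⟩
  have hw : HasWeakGradient u (weakGradient u) := by
    unfold weakGradient
    rw [dif_pos h]
    exact h.choose_spec
  exact hw.ae_eq hG

end Heisenberg

/-! Write M, A, B for the squared L² norms of u, ∇u and |x|u. For l > 0 the Gaussian γ =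
e^{-l|x|²/2} is the ground state of a harmonic oscillator with lowering operators ∂ᵢ + l xᵢ. Their
commutation with the raising operators (`norm_sq_eq_norm_sq_add`) gives Σ‖(∂ᵢ + l xᵢ)u‖² = A + l²B -
lNM, and the spectral gap (`poincare`) bounds this sum below by 2l‖u - cγ‖², where cγ is the
projection of u on γ. Together these are `MemX.poincare`.

Since ‖u - cγ‖ ≥ d₁ and d₁ does not depend on l, it follows that l(NM + 2d₁²) ≤ A + l²B for every l
> 0. Optimising in l gives (NM + 2d₁²)² ≤ 4AB, which is (1). Rescaling cγ to the norm of u at most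
doubles the squared distance (`exists_norm_smul_eq`), so (NM + d₂²)² ≤ 4AB, which is (2).

Sharpness and equality come from the single function xⱼe^{-|x|²/2}. It is orthogonal to all
Gaussians, so d₁² = M and d₂² = 2M, while its deficit is (N+1)M².

The gap and the commutation relation are computed on polynomials times γ. They pass to X by density
in L² and the weak adjoint relations alone, so elements of X need not be approximated in the norm of
X. -/

namespace Heisenberg

open MvPolynomial Filter
open scoped InnerProductSpace

/-! ### Ladder operators on polynomials -/

/-- The formal adjoint `κ xᵢ - ∂ᵢ` of `∂ᵢ` with respect to the Gaussian weight
`e^{-κ|x|²/2}`, acting on polynomials. -/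
noncomputable def adjDeriv {N : ℕ} (κ : ℝ) (i : Fin N) :
    MvPolynomial (Fin N) ℝ →ₗ[ℝ] MvPolynomial (Fin N) ℝ :=
  κ • LinearMap.mulLeft ℝ (X i) - (pderiv i).toLinearMap

theorem adjDeriv_apply {N : ℕ} (κ : ℝ) (i : Fin N) (P : MvPolynomial (Fin N) ℝ) :
    adjDeriv κ i P = κ • (X i * P) - pderiv i P := rfl

/-- The Ornstein–Uhlenbeck operator `κ x·∇ - Δ` on polynomials. -/
noncomputable def ornsteinUhlenbeck {N : ℕ} (κ : ℝ) :
    MvPolynomial (Fin N) ℝ →ₗ[ℝ] MvPolynomial (Fin N) ℝ :=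
  ∑ i, adjDeriv κ i ∘ₗ (pderiv i).toLinearMap

theorem ornsteinUhlenbeck_apply {N : ℕ} (κ : ℝ) (P : MvPolynomial (Fin N) ℝ) :
    ornsteinUhlenbeck κ P = ∑ i, adjDeriv κ i (pderiv i P) := by
  simp [ornsteinUhlenbeck]

theorem pderiv_comm' {N : ℕ} (i j : Fin N) (P : MvPolynomial (Fin N) ℝ) :
    pderiv i (pderiv j P) = pderiv j (pderiv i P) := by
  have h : ⁅(pderiv i : Derivation ℝ (MvPolynomial (Fin N) ℝ) (MvPolynomial (Fin N) ℝ)),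
      (pderiv j : Derivation ℝ (MvPolynomial (Fin N) ℝ) (MvPolynomial (Fin N) ℝ))⁆ = 0 := by
    refine MvPolynomial.derivation_ext fun k => ?_
    simp [Derivation.commutator_apply, pderiv_X, Pi.single_apply, apply_ite]
  have := congrArg (fun D => D P) h
  simpa [Derivation.commutator_apply, sub_eq_zero] using this

theorem pderiv_adjDeriv {N : ℕ} (κ : ℝ) (i j : Fin N) (P : MvPolynomial (Fin N) ℝ) :
    pderiv i (adjDeriv κ j P) = adjDeriv κ j (pderiv i P) + if i = j then κ • P else 0 := by
  rw [adjDeriv_apply, adjDeriv_apply, map_sub, pderiv_comm' i j]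
  rw [Derivation.map_smul, pderiv_mul]
  split_ifs with h
  · subst h
    rw [pderiv_X_self, one_mul, smul_add, add_sub_assoc, add_comm]
  · rw [pderiv_X_of_ne (Ne.symm h), zero_mul, zero_add, add_zero]

/-- The shift by κ under differentiation is the source of the spectral gap. -/
theorem pderiv_ornsteinUhlenbeck {N : ℕ} (κ : ℝ) (i : Fin N) (P : MvPolynomial (Fin N) ℝ) :
    pderiv i (ornsteinUhlenbeck κ P) = ornsteinUhlenbeck κ (pderiv i P) + κ • pderiv i P := by
  simp only [ornsteinUhlenbeck_apply, map_sum, pderiv_adjDeriv, Finset.sum_add_distrib]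
  rw [Finset.sum_ite_eq, if_pos (Finset.mem_univ i)]
  exact congrArg (· + κ • pderiv i P) (Finset.sum_congr rfl fun j _ => by rw [pderiv_comm'])

theorem ornsteinUhlenbeck_monomial {N : ℕ} (κ : ℝ) (s : Fin N →₀ ℕ) (a : ℝ) :
    ornsteinUhlenbeck κ (monomial s a)
      = (κ * s.degree) • monomial s a - ∑ i, pderiv i (pderiv i (monomial s a)) := by
  have h := (isHomogeneous_monomial (R := ℝ) (d := s) (n := s.degree) a rfl).sum_X_mul_pderiv
  simp only [ornsteinUhlenbeck_apply, adjDeriv_apply, Finset.sum_sub_distrib, ← Finset.smul_sum, h]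
  rw [mul_smul, Nat.cast_smul_eq_nsmul]

theorem degree_tsub_single {N : ℕ} (s : Fin N →₀ ℕ) (i : Fin N) (h : s i ≠ 0) :
    (s - Finsupp.single i 1).degree + 1 = s.degree := by
  have hle : Finsupp.single i 1 ≤ s := by
    rw [Finsupp.single_le_iff]; omega
  have := congrArg Finsupp.degree (tsub_add_cancel_of_le hle)
  simpa using this

/-- By Euler's identity the operator is triangular for the degree, with diagonal entries κ · degree.
These vanish only on constants, so induction on the degree solves the equation modulo constants. -/
theorem mem_range_ornsteinUhlenbeck_sup {N : ℕ} {κ : ℝ} (hκ : 0 < κ)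
    (P : MvPolynomial (Fin N) ℝ) :
    ∃ (Q : MvPolynomial (Fin N) ℝ) (c : ℝ), ornsteinUhlenbeck κ Q = P - C c := by
  let Z : Submodule ℝ (MvPolynomial (Fin N) ℝ) :=
    (ornsteinUhlenbeck κ).range ⊔ Submodule.span ℝ {1}
  have hmon : ∀ (n : ℕ) (s : Fin N →₀ ℕ) (a : ℝ), s.degree = n → monomial s a ∈ Z := by
    intro n
    induction n using Nat.strong_induction_on with
    | _ n ih =>
      intro s a hs
      rcases Nat.eq_zero_or_pos n with rfl | hn
      · rw [Finsupp.degree_eq_zero_iff] at hs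
        subst hs
        refine Submodule.mem_sup_right (Submodule.mem_span_singleton.2 ⟨a, ?_⟩)
        rw [← C_1, smul_eq_C_mul, ← C_mul, mul_one]; rfl
      · have hlap : ∀ i, pderiv i (pderiv i (monomial s a)) ∈ Z := by
          intro i
          rw [pderiv_monomial, pderiv_monomial]
          by_cases h1 : s i = 0
          · simp [h1]
          by_cases h2 : (s - Finsupp.single i 1 : Fin N →₀ ℕ) i = 0
          · rw [h2]; simp
          have e1 := degree_tsub_single s i h1
          have e2 := degree_tsub_single _ i h2
          exact ih _ (by omega) _ _ rfl
        have hT : ornsteinUhlenbeck κ (monomial s a) ∈ Z :=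
          Submodule.mem_sup_left (LinearMap.mem_range_self _ _)
        have hne : κ * (s.degree : ℝ) ≠ 0 := by
          rw [hs]; positivity
        have := Z.smul_mem (κ * (s.degree : ℝ))⁻¹ (Z.add_mem hT (Z.sum_mem (t := Finset.univ) fun i _ => hlap i))
        rw [ornsteinUhlenbeck_monomial, sub_add_cancel, smul_smul, inv_mul_cancel₀ hne,
          one_smul] at this
        exact this
  have hP : P ∈ Z := by
    rw [P.as_sum]
    exact Z.sum_mem fun s _ => hmon _ s _ rfl
  obtain ⟨y, ⟨Q, rfl⟩, z, hz, hyz⟩ := Submodule.mem_sup.1 hP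
  obtain ⟨c, rfl⟩ := Submodule.mem_span_singleton.1 hz
  refine ⟨Q, c, ?_⟩
  rw [← hyz, smul_eq_C_mul, mul_one, add_sub_cancel_right]

theorem pderiv_mem_restrictTotalDegree {N n : ℕ} (i : Fin N) {P : MvPolynomial (Fin N) ℝ}
    (hP : P ∈ restrictTotalDegree (Fin N) ℝ (n + 1)) :
    pderiv i P ∈ restrictTotalDegree (Fin N) ℝ n := by
  rw [mem_restrictTotalDegree] at hP
  rw [P.as_sum, map_sum]
  refine Submodule.sum_mem _ fun s hs => ?_
  rw [pderiv_monomial]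
  by_cases h : s i = 0
  · simp [h]
  rw [mem_restrictTotalDegree]
  have h1 := degree_tsub_single s i h
  have h2 : s.degree ≤ P.totalDegree := le_totalDegree hs
  refine (totalDegree_monomial_le _ _).trans ?_
  change (s - Finsupp.single i 1).degree ≤ n
  omega

theorem adjDeriv_mem_restrictTotalDegree {N n : ℕ} (κ : ℝ) (i : Fin N)
    {P : MvPolynomial (Fin N) ℝ} (hP : P ∈ restrictTotalDegree (Fin N) ℝ n) :
    adjDeriv κ i P ∈ restrictTotalDegree (Fin N) ℝ (n + 1) := by
  rw [adjDeriv_apply]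
  rw [mem_restrictTotalDegree] at hP
  refine Submodule.sub_mem _ (Submodule.smul_mem _ _ ?_) ?_
  · rw [mem_restrictTotalDegree]
    refine (totalDegree_mul _ _).trans ?_
    rw [totalDegree_X]; omega
  · have h1 : P ∈ restrictTotalDegree (Fin N) ℝ (n + 1) := by
      rw [mem_restrictTotalDegree]; omega
    have := pderiv_mem_restrictTotalDegree i h1
    rw [mem_restrictTotalDegree] at this ⊢
    omega

/-! ### Spectral gap and commutation relation in an abstract Hilbert space -/

section Hilbert

variable {N : ℕ} {H : Type*} [NormedAddCommGroup H] [InnerProductSpace ℝ H] {κ : ℝ}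
  {Ψ : MvPolynomial (Fin N) ℝ →ₗ[ℝ] H}

theorem inner_ornsteinUhlenbeck
    (hadj : ∀ i P Q, ⟪Ψ (pderiv i P), Ψ Q⟫_ℝ = ⟪Ψ P, Ψ (adjDeriv κ i Q)⟫_ℝ)
    (P Q : MvPolynomial (Fin N) ℝ) :
    ⟪Ψ P, Ψ (ornsteinUhlenbeck κ Q)⟫_ℝ = ∑ i, ⟪Ψ (pderiv i P), Ψ (pderiv i Q)⟫_ℝ := by
  simp [ornsteinUhlenbeck_apply, inner_sum, hadj]

/-- A Bochner argument: moving one factor across the inner product and commuting it past ∂ᵢ leaves κ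
Σ‖∂ᵢQ‖² plus the squares of the second derivatives, which are dropped. -/
theorem sum_norm_pderiv_sq_le
    (hadj : ∀ i P Q, ⟪Ψ (pderiv i P), Ψ Q⟫_ℝ = ⟪Ψ P, Ψ (adjDeriv κ i Q)⟫_ℝ)
    (Q : MvPolynomial (Fin N) ℝ) :
    κ * ∑ i, ‖Ψ (pderiv i Q)‖ ^ 2 ≤ ‖Ψ (ornsteinUhlenbeck κ Q)‖ ^ 2 := by
  rw [← real_inner_self_eq_norm_sq, inner_ornsteinUhlenbeck hadj, Finset.mul_sum]
  refine Finset.sum_le_sum fun i _ => ?_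
  rw [real_inner_comm, pderiv_ornsteinUhlenbeck, map_add, inner_add_right,
    inner_ornsteinUhlenbeck hadj, map_smul, real_inner_smul_right, real_inner_self_eq_norm_sq]
  have : 0 ≤ ∑ j, ⟪Ψ (pderiv j (pderiv i Q)), Ψ (pderiv j (pderiv i Q))⟫_ℝ :=
    Finset.sum_nonneg fun j _ => real_inner_self_nonneg
  linarith

/-- The Poincaré inequality for vectors orthogonal to the ground state. -/
theorem poincare_of_inner_eq_zero (hκ : 0 < κ)
    (hadj : ∀ i P Q, ⟪Ψ (pderiv i P), Ψ Q⟫_ℝ = ⟪Ψ P, Ψ (adjDeriv κ i Q)⟫_ℝ)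
    (hΨ : DenseRange Ψ) {u : H} {D : Fin N → H}
    (hD : ∀ i P, ⟪D i, Ψ P⟫_ℝ = ⟪u, Ψ (adjDeriv κ i P)⟫_ℝ) (hu : ⟪u, Ψ 1⟫_ℝ = 0) :
    κ * ‖u‖ ^ 2 ≤ ∑ i, ‖D i‖ ^ 2 := by
  -- Duality: u is tested against P = LQ + c, with L the Ornstein–Uhlenbeck operator. The pairing
  -- becomes Σ⟨Dᵢ, ∂ᵢQ⟩, and Q is controlled by the Bochner bound. Only the weak relation defining
  -- Dᵢ is used.
  have key : ∀ P, κ * ⟪u, Ψ P⟫_ℝ ^ 2 ≤ (∑ i, ‖D i‖ ^ 2) * ‖Ψ P‖ ^ 2 := by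
    intro P
    obtain ⟨Q, c, hQ⟩ := mem_range_ornsteinUhlenbeck_sup hκ P
    have hP : P = ornsteinUhlenbeck κ Q + c • 1 := by
      rw [hQ, smul_eq_C_mul, mul_one, sub_add_cancel]
    have h1 : ⟪Ψ 1, Ψ (ornsteinUhlenbeck κ Q)⟫_ℝ = 0 := by
      rw [inner_ornsteinUhlenbeck hadj]
      simp
    have h2 : ⟪u, Ψ P⟫_ℝ = ∑ i, ⟪D i, Ψ (pderiv i Q)⟫_ℝ := by
      rw [hP, map_add, inner_add_right, map_smul, real_inner_smul_right, hu, mul_zero, add_zero,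
        ornsteinUhlenbeck_apply]
      simp [inner_sum, hD]
    -- The range of L is orthogonal to the ground state, so discarding c can only shrink the norm.
    have h3 : ‖Ψ (ornsteinUhlenbeck κ Q)‖ ^ 2 ≤ ‖Ψ P‖ ^ 2 := by
      rw [hP, map_add, map_smul, norm_add_sq_real, real_inner_smul_right, real_inner_comm, h1]
      nlinarith [sq_nonneg ‖c • Ψ 1‖]
    have h4 : ⟪u, Ψ P⟫_ℝ ^ 2 ≤ (∑ i, ‖D i‖ ^ 2) * ∑ i, ‖Ψ (pderiv i Q)‖ ^ 2 := by
      rw [h2]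
      refine le_trans ?_ (Finset.sum_mul_sq_le_sq_mul_sq Finset.univ (fun i => ‖D i‖)
        (fun i => ‖Ψ (pderiv i Q)‖))
      rw [sq_le_sq]
      refine ((Finset.abs_sum_le_sum_abs _ _).trans
        (Finset.sum_le_sum fun i _ => abs_real_inner_le_norm _ _)).trans (le_abs_self _)
    have h0 : 0 ≤ ∑ i, ‖D i‖ ^ 2 := Finset.sum_nonneg fun i _ => sq_nonneg _
    calc κ * ⟪u, Ψ P⟫_ℝ ^ 2 ≤ κ * ((∑ i, ‖D i‖ ^ 2) * ∑ i, ‖Ψ (pderiv i Q)‖ ^ 2) := by gcongr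
      _ = (∑ i, ‖D i‖ ^ 2) * (κ * ∑ i, ‖Ψ (pderiv i Q)‖ ^ 2) := by ring
      _ ≤ _ := mul_le_mul_of_nonneg_left ((sum_norm_pderiv_sq_le hadj Q).trans h3) h0
  -- By density the test vector may be u itself; one factor ‖u‖² then cancels.
  have := isClosed_property (p := fun v => κ * ⟪u, v⟫_ℝ ^ 2 ≤ (∑ i, ‖D i‖ ^ 2) * ‖v‖ ^ 2) hΨ
    (isClosed_le (by fun_prop) (by fun_prop)) key u
  rw [real_inner_self_eq_norm_sq] at this
  rcases eq_or_lt_of_le (sq_nonneg ‖u‖) with h | h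
  · rw [← h, mul_zero]
    exact Finset.sum_nonneg fun i _ => sq_nonneg _
  · refine le_of_mul_le_mul_right ?_ h
    nlinarith

/-- Lowering kills the ground state, so subtracting a multiple of it leaves the vectors Dᵢ
unchanged. -/
theorem poincare (hκ : 0 < κ)
    (hadj : ∀ i P Q, ⟪Ψ (pderiv i P), Ψ Q⟫_ℝ = ⟪Ψ P, Ψ (adjDeriv κ i Q)⟫_ℝ)
    (hΨ : DenseRange Ψ) {u : H} {D : Fin N → H}
    (hD : ∀ i P, ⟪D i, Ψ P⟫_ℝ = ⟪u, Ψ (adjDeriv κ i P)⟫_ℝ) {c : ℝ}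
    (hc : ⟪u - c • Ψ 1, Ψ 1⟫_ℝ = 0) :
    κ * ‖u - c • Ψ 1‖ ^ 2 ≤ ∑ i, ‖D i‖ ^ 2 := by
  refine poincare_of_inner_eq_zero hκ hadj hΨ (fun i P => ?_) hc
  rw [inner_sub_left, real_inner_smul_left, ← hadj, hD]
  simp

/-- The canonical commutation relation, in quadratic form. -/
theorem norm_sq_eq_norm_sq_add [CompleteSpace H]
    (hadj : ∀ i P Q, ⟪Ψ (pderiv i P), Ψ Q⟫_ℝ = ⟪Ψ P, Ψ (adjDeriv κ i Q)⟫_ℝ)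
    (hΨ : DenseRange Ψ) {u d d' : H} {i : Fin N}
    (hd : ∀ P, ⟪d, Ψ P⟫_ℝ = ⟪u, Ψ (adjDeriv κ i P)⟫_ℝ)
    (hd' : ∀ P, ⟪d', Ψ P⟫_ℝ = ⟪u, Ψ (pderiv i P)⟫_ℝ) :
    ‖d'‖ ^ 2 = ‖d‖ ^ 2 + κ * ‖u‖ ^ 2 := by
  -- As d and d' are known only weakly, everything is projected to bounded degree, where the
  -- relation is algebraic, and the degree then tends to infinity.
  let V : ℕ → Submodule ℝ H := fun n => (restrictTotalDegree (Fin N) ℝ n).map Ψ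
  have hmono : Monotone V := by
    intro m n hmn
    refine Submodule.map_mono fun P hP => ?_
    rw [mem_restrictTotalDegree] at hP ⊢
    omega
  have hdense : ⊤ ≤ (⨆ n, V n).topologicalClosure := by
    intro x _
    rw [← SetLike.mem_coe, Submodule.topologicalClosure_coe]
    refine closure_mono ?_ (hΨ x)
    rintro _ ⟨P, rfl⟩
    exact Submodule.mem_iSup_of_mem P.totalDegree
      ⟨P, (mem_restrictTotalDegree _ _ _).2 le_rfl, rfl⟩
  have hlim : ∀ x, Tendsto (fun n => (V n).starProjection x) atTop (nhds x) :=
    fun x => Submodule.starProjection_tendsto_self V hmono x hdense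
  have hlim' : ∀ (k : ℕ) x, Tendsto (fun n => ‖(V (n + k)).starProjection x‖ ^ 2) atTop
      (nhds (‖x‖ ^ 2)) :=
    fun k x => (((hlim x).comp (tendsto_add_atTop_nat k)).norm.pow 2)
  have hproj : ∀ n x y, y ∈ V n → ⟪(V n).starProjection x, y⟫_ℝ = ⟪x, y⟫_ℝ := by
    intro n x y hy
    rw [Submodule.inner_starProjection_left_eq_right, Submodule.starProjection_eq_self_iff.2 hy]
  -- With u cut at degree n + 1, lowering lands in degree n and raising in degree n + 2. With
  -- exactly these cutoffs the projections of d and d' are the lowered and raised truncation of u.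
  have key : ∀ n, ‖(V (n + 2)).starProjection d'‖ ^ 2
      = ‖(V (n + 0)).starProjection d‖ ^ 2 + κ * ‖(V (n + 1)).starProjection u‖ ^ 2 := by
    intro n
    obtain ⟨P, hP, hPu⟩ := (V (n + 1)).starProjection_apply_mem u
    have h1 : (V (n + 0)).starProjection d = Ψ (pderiv i P) := by
      refine Submodule.eq_starProjection_of_mem_of_inner_eq_zero
        ⟨_, pderiv_mem_restrictTotalDegree i hP, rfl⟩ ?_
      rintro _ ⟨Q, hQ, rfl⟩
      rw [inner_sub_left, hadj, hPu, hproj _ _ _ ⟨_, adjDeriv_mem_restrictTotalDegree κ i hQ, rfl⟩,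
        hd, sub_self]
    have h2 : (V (n + 2)).starProjection d' = Ψ (adjDeriv κ i P) := by
      refine Submodule.eq_starProjection_of_mem_of_inner_eq_zero
        ⟨_, adjDeriv_mem_restrictTotalDegree κ i hP, rfl⟩ ?_
      rintro _ ⟨Q, hQ, rfl⟩
      rw [inner_sub_left, real_inner_comm (Ψ Q) (Ψ (adjDeriv κ i P)), ← hadj,
        real_inner_comm (Ψ P), hPu,
        hproj _ _ _ ⟨_, pderiv_mem_restrictTotalDegree i hQ, rfl⟩, hd', sub_self]
    rw [h1, h2, ← hPu, ← real_inner_self_eq_norm_sq, ← hadj, pderiv_adjDeriv, if_pos rfl, map_add,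
      inner_add_left, map_smul, real_inner_smul_left, real_inner_comm, ← hadj]
    simp only [real_inner_self_eq_norm_sq]
  exact tendsto_nhds_unique ((hlim' 2 d').congr key)
    ((hlim' 0 d).add ((hlim' 1 u).const_mul κ))

end Hilbert

variable {N : ℕ}

/-! ### Polynomials times a Gaussian: smoothness and integrability -/

/-- A polynomial times the Gaussian `e^{-l|x|²/2}`. -/
noncomputable def hermiteFun (l : ℝ) (P : MvPolynomial (Fin N) ℝ) (x : EuclideanSpace ℝ (Fin N)) :
    ℝ :=
  eval (fun i => x i) P * Real.exp (-(l / 2) * ‖x‖ ^ 2)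

theorem integrable_exp_neg_mul_norm_sq {b : ℝ} (hb : 0 < b) :
    Integrable (fun x : EuclideanSpace ℝ (Fin N) => Real.exp (-b * ‖x‖ ^ 2)) := by
  have h := (GaussianFourier.integrable_cexp_neg_mul_sq_norm_add (b := (b : ℂ)) (by simpa using hb)
    0 (0 : EuclideanSpace ℝ (Fin N))).norm
  refine h.congr (Eventually.of_forall fun x => ?_)
  simp only [Complex.norm_exp]
  congr 1
  norm_cast
  simp

theorem memLp_exp_norm_mul_gaussian (a : ℝ) {b : ℝ} (hb : 0 < b) :
    MemLp (fun x : EuclideanSpace ℝ (Fin N) => Real.exp (a * ‖x‖) * Real.exp (-b * ‖x‖ ^ 2)) 2 := by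
  rw [memLp_two_iff_integrable_sq (by fun_prop)]
  -- Completing the square: 2a‖x‖ - 2b‖x‖² ≤ a²/b - b‖x‖².
  refine Integrable.mono' ((integrable_exp_neg_mul_norm_sq hb).const_mul (Real.exp (a ^ 2 / b)))
    (by fun_prop) (Eventually.of_forall fun x => ?_)
  rw [Real.norm_of_nonneg (by positivity), ← Real.exp_add, ← Real.exp_add, ← Real.exp_nat_mul,
    Real.exp_le_exp]
  have h : a ^ 2 / b - 2 * a * ‖x‖ + b * ‖x‖ ^ 2 = (a - b * ‖x‖) ^ 2 / b := by
    field_simp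
    ring
  have h' : 0 ≤ (a - b * ‖x‖) ^ 2 / b := by positivity
  push_cast
  linarith

/-- An exponential bound passes easily through the induction, since |xᵢ| ≤ e^{‖x‖}, and the Gaussian
still absorbs it. -/
theorem abs_eval_le (P : MvPolynomial (Fin N) ℝ) :
    ∃ C a : ℝ, 0 ≤ C ∧ 0 ≤ a ∧
      ∀ x : EuclideanSpace ℝ (Fin N), |eval (fun i => x i) P| ≤ C * Real.exp (a * ‖x‖) := by
  induction P using MvPolynomial.induction_on with
  | C c => exact ⟨|c|, 0, abs_nonneg _, le_rfl, fun x => by simp⟩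
  | add p q hp hq =>
    obtain ⟨C, a, hC, ha, h⟩ := hp
    obtain ⟨C', a', hC', ha', h'⟩ := hq
    refine ⟨C + C', a + a', by positivity, by positivity, fun x => ?_⟩
    rw [map_add, add_mul]
    refine (abs_add_le _ _).trans (add_le_add ((h x).trans ?_) ((h' x).trans ?_)) <;> gcongr <;>
      linarith
  | mul_X p i hp =>
    obtain ⟨C, a, hC, ha, h⟩ := hp
    refine ⟨C, a + 1, hC, by positivity, fun x => ?_⟩
    rw [map_mul, eval_X, abs_mul, add_mul, Real.exp_add, ← mul_assoc]
    refine mul_le_mul (h x) ?_ (abs_nonneg _) (by positivity)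
    have h1 : |x i| ≤ ‖x‖ := PiLp.norm_apply_le x i
    have h2 := Real.add_one_le_exp (1 * ‖x‖)
    linarith

theorem contDiff_eval (P : MvPolynomial (Fin N) ℝ) :
    ContDiff ℝ ∞ (fun x : EuclideanSpace ℝ (Fin N) => eval (fun i => x i) P) := by
  induction P using MvPolynomial.induction_on with
  | C c => simpa using contDiff_const
  | add p q hp hq => simpa using hp.add hq
  | mul_X p i hp =>
    simp only [map_mul, eval_X]
    exact hp.mul (EuclideanSpace.proj (𝕜 := ℝ) i).contDiff

theorem fderiv_eval (P : MvPolynomial (Fin N) ℝ) (i : Fin N) (x : EuclideanSpace ℝ (Fin N)) :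
    fderiv ℝ (fun x : EuclideanSpace ℝ (Fin N) => eval (fun i => x i) P) x
      (EuclideanSpace.single i 1) = eval (fun i => x i) (pderiv i P) := by
  have hdiff := fun Q : MvPolynomial (Fin N) ℝ => (contDiff_eval Q).differentiable (by simp) x
  induction P using MvPolynomial.induction_on with
  | C c => simp
  | add p q hp hq =>
    simp only [map_add]
    rw [fderiv_fun_add (hdiff p) (hdiff q), add_apply, hp, hq]
  | mul_X p j hp =>
    have hj : HasFDerivAt (fun x : EuclideanSpace ℝ (Fin N) => x j)
        (EuclideanSpace.proj (𝕜 := ℝ) j) x := (EuclideanSpace.proj (𝕜 := ℝ) j).hasFDerivAt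
    simp only [map_mul, eval_X, pderiv_mul, map_add]
    rw [((hdiff p).hasFDerivAt.fun_mul hj).fderiv]
    simp only [add_apply, smul_apply, smul_eq_mul, hp, PiLp.proj_apply,
      PiLp.single_apply]
    by_cases h : j = i
    · subst h; simp; ring
    · simp [h, pderiv_X_of_ne h]; ring

theorem contDiff_hermiteFun (l : ℝ) (P : MvPolynomial (Fin N) ℝ) :
    ContDiff ℝ ∞ (hermiteFun l P) :=
  (contDiff_eval P).mul ((contDiff_const.mul (contDiff_norm_sq ℝ)).exp)

theorem continuous_hermiteFun (l : ℝ) (P : MvPolynomial (Fin N) ℝ) :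
    Continuous (hermiteFun l P) :=
  (contDiff_hermiteFun l P).continuous

theorem fderiv_hermiteFun (l : ℝ) (P : MvPolynomial (Fin N) ℝ) (i : Fin N)
    (x : EuclideanSpace ℝ (Fin N)) :
    fderiv ℝ (hermiteFun l P) x (EuclideanSpace.single i 1)
      = hermiteFun l (pderiv i P) x - l * (x i * hermiteFun l P x) := by
  have h1 := ((contDiff_eval P).differentiable (by simp) x).hasFDerivAt
  have h2 := (((hasStrictFDerivAt_norm_sq x).hasFDerivAt).const_mul (-(l / 2))).exp
  have h3 := (h1.fun_mul h2).fderiv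
  have h4 : hermiteFun l P = fun y => eval (fun i => y i) P * Real.exp (-(l / 2) * ‖y‖ ^ 2) := rfl
  rw [h4, h3]
  simp only [add_apply, smul_apply, fderiv_eval,
    innerSL_apply_apply, EuclideanSpace.inner_single_right, hermiteFun, smul_eq_mul]
  simp
  ring

theorem memLp_hermiteFun {l : ℝ} (hl : 0 < l) (P : MvPolynomial (Fin N) ℝ) :
    MemLp (hermiteFun l P) 2 := by
  obtain ⟨C, a, hC, ha, h⟩ := abs_eval_le P
  refine (memLp_exp_norm_mul_gaussian a (half_pos hl)).of_le_mul (c := C)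
    (continuous_hermiteFun l P).aestronglyMeasurable (Eventually.of_forall fun x => ?_)
  rw [hermiteFun, norm_mul, norm_mul, Real.norm_eq_abs, ← mul_assoc, Real.norm_of_nonneg (Real.exp_nonneg _),
    Real.norm_of_nonneg (Real.exp_nonneg _)]
  gcongr
  exact h x

theorem coord_mul_hermiteFun (l : ℝ) (i : Fin N) (P : MvPolynomial (Fin N) ℝ)
    (x : EuclideanSpace ℝ (Fin N)) : x i * hermiteFun l P x = hermiteFun l (X i * P) x := by
  simp only [hermiteFun, map_mul, eval_X]
  ring

/-! ### Weak gradients against non-compactly supported functions -/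

/-- The definition of a weak gradient extends to test functions without compact support. -/
theorem HasWeakGradient.integral_mul_fderiv {u : EuclideanSpace ℝ (Fin N) → ℝ}
    {G : EuclideanSpace ℝ (Fin N) → EuclideanSpace ℝ (Fin N)} (hG : HasWeakGradient u G)
    {ψ : EuclideanSpace ℝ (Fin N) → ℝ} (hψ : ContDiff ℝ ∞ ψ) (i : Fin N)
    (h1 : Integrable (fun x => u x * ψ x))
    (h2 : Integrable (fun x => u x * fderiv ℝ ψ x (EuclideanSpace.single i 1)))
    (h3 : Integrable (fun x => G x i * ψ x)) :
    ∫ x, u x * fderiv ℝ ψ x (EuclideanSpace.single i 1) = - ∫ x, G x i * ψ x := by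
  set e : EuclideanSpace ℝ (Fin N) := EuclideanSpace.single i 1
  -- The cutoffs χ(x/(n+1)) tend to 1 and their derivatives are O(1/n) uniformly, so dominated
  -- convergence removes them.
  let χ : ContDiffBump (0 : EuclideanSpace ℝ (Fin N)) := ⟨1, 2, one_pos, one_lt_two⟩
  have hχs : ContDiff ℝ ∞ χ := χ.contDiff
  obtain ⟨K, hK⟩ := (hχs.continuous_fderiv (by simp)).bounded_above_of_compact_support
    (χ.hasCompactSupport.fderiv (𝕜 := ℝ))
  let r : ℕ → ℝ := fun n => ((n : ℝ) + 1)⁻¹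
  have hr0 : ∀ n, 0 < r n := fun n => by positivity
  have hr1 : ∀ n, r n ≤ 1 := fun n => inv_le_one_of_one_le₀ (by simp)
  have hr : Tendsto r atTop (nhds 0) := by
    simpa [r, one_div] using tendsto_one_div_add_atTop_nhds_zero_nat (𝕜 := ℝ)
  let c : ℕ → EuclideanSpace ℝ (Fin N) → ℝ := fun n x => χ (r n • x)
  have hcs : ∀ n, ContDiff ℝ ∞ (c n) := fun n => hχs.comp (contDiff_const_smul (r n))
  have hcsupp : ∀ n, HasCompactSupport (c n) := fun n =>
    χ.hasCompactSupport.comp_homeomorph (Homeomorph.smulOfNeZero (r n) (hr0 n).ne')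
  have hcd : ∀ n x, fderiv ℝ (c n) x e = r n * fderiv ℝ χ (r n • x) e := by
    intro n x
    have h : HasFDerivAt (c n) ((fderiv ℝ χ (r n • x)).comp (r n • ContinuousLinearMap.id ℝ _)) x :=
      ((hχs.differentiable (by simp) (r n • x)).hasFDerivAt).comp x
        ((hasFDerivAt_id x).const_smul (r n))
    rw [h.fderiv]
    simp
  have hc1 : ∀ n x, |c n x| ≤ 1 := fun n x => by
    rw [abs_of_nonneg χ.nonneg]; exact χ.le_one
  have hcdb : ∀ n x, |fderiv ℝ (c n) x e| ≤ K := by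
    intro n x
    rw [hcd, abs_mul, abs_of_pos (hr0 n)]
    have : |fderiv ℝ χ (r n • x) e| ≤ K := by
      refine ((fderiv ℝ χ (r n • x)).le_opNorm e).trans ?_
      simpa [e] using hK (r n • x)
    nlinarith [hr0 n, hr1 n, abs_nonneg (fderiv ℝ χ (r n • x) e)]
  have hclim : ∀ x, Tendsto (fun n => c n x) atTop (nhds 1) := by
    intro x
    have h : Tendsto (fun n => χ (r n • x)) atTop (nhds (χ ((0 : ℝ) • x))) :=
      (hχs.continuous.tendsto _).comp (hr.smul_const x)
    rwa [zero_smul, χ.one_of_mem_closedBall (by simp [χ])] at h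
  have hcdlim : ∀ x, Tendsto (fun n => fderiv ℝ (c n) x e) atTop (nhds 0) := by
    intro x
    simp only [hcd]
    have h : Tendsto (fun n => fderiv ℝ χ (r n • x) e) atTop
        (nhds (fderiv ℝ χ ((0 : ℝ) • x) e)) :=
      ((((hχs.continuous_fderiv (by simp)).clm_apply continuous_const).tendsto _).comp
        (hr.smul_const x))
    simpa using hr.mul h
  have hd : ∀ n x, fderiv ℝ (fun y => c n y * ψ y) x e
      = c n x * fderiv ℝ ψ x e + ψ x * fderiv ℝ (c n) x e := by
    intro n x
    rw [fderiv_fun_mul ((hcs n).differentiable (by simp) x) (hψ.differentiable (by simp) x)]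
    simp
  have heq : ∀ n, ∫ x, (c n x * (u x * fderiv ℝ ψ x e) + fderiv ℝ (c n) x e * (u x * ψ x))
      = - ∫ x, c n x * (G x i * ψ x) := by
    intro n
    have := hG.integral_eq (fun y => c n y * ψ y) ((hcs n).mul hψ) ((hcsupp n).mul_right) i
    simp only [e] at hd
    simp only [hd] at this
    refine (integral_congr_ae (Eventually.of_forall fun x => ?_)).trans
      (this.trans (congrArg _ (integral_congr_ae (Eventually.of_forall fun x => ?_))))
    · simp only [e]; ring
    · simp only; ring
  have hcm : ∀ n, AEStronglyMeasurable (c n) := fun n => (hcs n).continuous.aestronglyMeasurable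
  have hcdm : ∀ n, AEStronglyMeasurable (fun x => fderiv ℝ (c n) x e) := fun n =>
    (((hcs n).continuous_fderiv (by simp)).clm_apply continuous_const).aestronglyMeasurable
  have hl1 : Tendsto (fun n => ∫ x, (c n x * (u x * fderiv ℝ ψ x e)
      + fderiv ℝ (c n) x e * (u x * ψ x))) atTop (nhds (∫ x, u x * fderiv ℝ ψ x e)) := by
    refine tendsto_integral_of_dominated_convergence
      (fun x => ‖u x * fderiv ℝ ψ x e‖ + K * ‖u x * ψ x‖)
      (fun n => ((hcm n).mul h2.1).add ((hcdm n).mul h1.1)) (h2.norm.add (h1.norm.const_mul K))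
      (fun n => Eventually.of_forall fun x => ?_) (Eventually.of_forall fun x => ?_)
    · refine (norm_add_le _ _).trans (add_le_add ?_ ?_)
      · rw [norm_mul]
        exact mul_le_of_le_one_left (norm_nonneg _) (hc1 n x)
      · rw [norm_mul]
        exact mul_le_mul_of_nonneg_right (hcdb n x) (norm_nonneg _)
    · simpa using ((hclim x).mul_const (u x * fderiv ℝ ψ x e)).add
        ((hcdlim x).mul_const (u x * ψ x))
  have hl2 : Tendsto (fun n => ∫ x, c n x * (G x i * ψ x)) atTop (nhds (∫ x, G x i * ψ x)) := by
    refine tendsto_integral_of_dominated_convergence (fun x => ‖G x i * ψ x‖)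
      (fun n => (hcm n).mul h3.1) h3.norm
      (fun n => Eventually.of_forall fun x => ?_) (Eventually.of_forall fun x => ?_)
    · rw [norm_mul]
      exact mul_le_of_le_one_left (norm_nonneg _) (hc1 n x)
    · simpa using (hclim x).mul_const (G x i * ψ x)
  exact tendsto_nhds_unique (hl1.congr heq) hl2.neg

/-! ### Density in L² by uniqueness of the Fourier transform -/

/-- In the power series of e^{i⟨x,t⟩} each term is a polynomial, hence integrates to zero. The sum
may be exchanged with the integral because e^{‖x‖‖t‖} times the Gaussian is in L². -/
theorem integral_cexp_inner_mul_eq_zero {l : ℝ} (hl : 0 < l) {f : EuclideanSpace ℝ (Fin N) → ℝ}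
    (hf : MemLp f 2) (h : ∀ P, ∫ x, f x * hermiteFun l P x = 0) (t : EuclideanSpace ℝ (Fin N)) :
    ∫ x, Complex.exp (⟪x, t⟫_ℝ * Complex.I) * (f x * hermiteFun l 1 x : ℝ) = 0 := by
  let F : ℕ → EuclideanSpace ℝ (Fin N) → ℂ := fun n x =>
    ((Complex.I ^ n / n.factorial : ℂ)) * (f x * hermiteFun l ((∑ i, C (t i) * X i) ^ n) x : ℝ)
  have hpow : ∀ n x, hermiteFun l ((∑ i, C (t i) * X i) ^ n) x
      = ⟪x, t⟫_ℝ ^ n * hermiteFun l 1 x := by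
    intro n x
    simp [hermiteFun, PiLp.inner_apply]
  have hF : ∀ n x, F n x = ((⟪x, t⟫_ℝ * Complex.I) ^ n / n.factorial)
      * (f x * hermiteFun l 1 x : ℝ) := by
    intro n x
    simp only [F, hpow]
    push_cast
    ring
  have hsum : ∀ x, HasSum (fun n => (‖x‖ * ‖t‖) ^ n / n.factorial * |f x * hermiteFun l 1 x|)
      (Real.exp (‖x‖ * ‖t‖) * |f x * hermiteFun l 1 x|) := by
    intro x
    refine HasSum.mul_right _ ?_
    rw [Real.exp_eq_exp_ℝ]
    exact NormedSpace.expSeries_div_hasSum_exp (‖x‖ * ‖t‖)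
  have hint : HasSum (fun n => ∫ x, F n x)
      (∫ x, Complex.exp (⟪x, t⟫_ℝ * Complex.I) * (f x * hermiteFun l 1 x : ℝ)) := by
    refine hasSum_integral_of_dominated_convergence
      (fun n x => (‖x‖ * ‖t‖) ^ n / n.factorial * |f x * hermiteFun l 1 x|) (fun n => ?_)
      (fun n => Eventually.of_forall fun x => ?_) (Eventually.of_forall fun x => (hsum x).summable)
      ?_ (Eventually.of_forall fun x => ?_)
    · exact ((Complex.continuous_ofReal.comp_aestronglyMeasurable
        (hf.1.mul (continuous_hermiteFun l _).aestronglyMeasurable)).const_mul _)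
    · rw [hF, norm_mul, norm_div, norm_pow, norm_mul, Complex.norm_I, mul_one, Complex.norm_natCast,
        Complex.norm_real, Complex.norm_real, Real.norm_eq_abs (_ * _)]
      gcongr
      exact norm_inner_le_norm x t
    · simp only [(hsum _).tsum_eq]
      refine ((hf.integrable_mul (memLp_exp_norm_mul_gaussian ‖t‖ (half_pos hl))).norm).congr
        (Eventually.of_forall fun x => ?_)
      simp only [Pi.mul_apply, hermiteFun, map_one, one_mul, Real.norm_eq_abs, abs_mul,
        Real.abs_exp]
      rw [mul_comm ‖t‖]
      ring
    · simp only [hF]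
      refine HasSum.mul_right _ ?_
      rw [Complex.exp_eq_exp_ℂ]
      exact NormedSpace.expSeries_div_hasSum_exp _
  refine hint.unique ?_
  have : ∀ n, ∫ x, F n x = 0 := by
    intro n
    simp only [F]
    rw [integral_const_mul, integral_complex_ofReal, h]
    simp
  simp [this]

/-- The positive and negative parts of F are densities of finite measures with the same
characteristic function, so these measures coincide. -/
theorem ae_eq_zero_of_forall_integral_cexp_inner {F : EuclideanSpace ℝ (Fin N) → ℝ}
    (hF : Integrable F)
    (h : ∀ t, ∫ x, Complex.exp (⟪x, t⟫_ℝ * Complex.I) * (F x : ℂ) = 0) : F =ᵐ[volume] 0 := by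
  have h1 := isFiniteMeasure_withDensity_ofReal hF.2
  have h2 := isFiniteMeasure_withDensity_ofReal hF.neg.2
  have hm1 : AEMeasurable (fun x => ENNReal.ofReal (F x)) := hF.1.aemeasurable.ennreal_ofReal
  have hm2 : AEMeasurable (fun x => ENNReal.ofReal ((-F) x)) := hF.neg.1.aemeasurable.ennreal_ofReal
  have heq : (volume.withDensity fun x => ENNReal.ofReal (F x))
      = volume.withDensity fun x => ENNReal.ofReal ((-F) x) := by
    refine Measure.ext_of_charFun (funext fun t => ?_)
    rw [charFun_apply, charFun_apply, integral_withDensity_eq_integral_toReal_smul₀ hm1 (by simp),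
      integral_withDensity_eq_integral_toReal_smul₀ hm2 (by simp), ← sub_eq_zero]
    have hint : ∀ {G : EuclideanSpace ℝ (Fin N) → ℝ}, Integrable G →
        Integrable (fun x => (ENNReal.ofReal (G x)).toReal •
          Complex.exp (⟪x, t⟫_ℝ * Complex.I)) := by
      intro G hG
      refine hG.norm.mono' ?_ (Eventually.of_forall fun x => ?_)
      · exact (hG.1.aemeasurable.ennreal_ofReal.ennreal_toReal.aestronglyMeasurable).smul
          (Continuous.aestronglyMeasurable (by fun_prop))
      · rw [norm_smul, Complex.norm_exp_ofReal_mul_I, mul_one, ENNReal.toReal_ofReal',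
          Real.norm_of_nonneg (le_max_right _ _)]
        exact max_le (le_abs_self _) (abs_nonneg _)
    rw [← integral_sub (hint hF) (hint hF.neg), ← h t]
    refine integral_congr_ae (Eventually.of_forall fun x => ?_)
    simp only [ENNReal.toReal_ofReal', Pi.neg_apply]
    rw [← sub_smul, max_zero_sub_max_neg_zero_eq_self, mul_comm (Complex.exp _), Complex.real_smul]
  rw [withDensity_eq_iff hm1 hm2] at heq
  · filter_upwards [heq] with x hx
    rcases le_total (F x) 0 with hx' | hx'
    · rw [ENNReal.ofReal_of_nonpos hx', eq_comm, ENNReal.ofReal_eq_zero] at hx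
      simp only [Pi.neg_apply] at hx
      simp only [Pi.zero_apply]
      linarith
    · have h0 : (-F) x ≤ 0 := by simpa using hx'
      rw [ENNReal.ofReal_of_nonpos h0, ENNReal.ofReal_eq_zero] at hx
      exact le_antisymm hx hx'
  · exact ((lintegral_mono fun x => Real.ofReal_le_enorm (F x)).trans_lt hF.2).ne

theorem inner_toLp {f g : EuclideanSpace ℝ (Fin N) → ℝ} (hf : MemLp f 2) (hg : MemLp g 2) :
    ⟪hf.toLp f, hg.toLp g⟫_ℝ = ∫ x, f x * g x := by
  rw [L2.inner_def]
  refine integral_congr_ae ?_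
  filter_upwards [hf.coeFn_toLp, hg.coeFn_toLp] with x h1 h2
  rw [h1, h2]
  simp [mul_comm]

theorem norm_toLp_sq {f : EuclideanSpace ℝ (Fin N) → ℝ} (hf : MemLp f 2) :
    ‖hf.toLp f‖ ^ 2 = ∫ x, f x ^ 2 := by
  rw [← real_inner_self_eq_norm_sq, inner_toLp]
  simp only [sq]

/-- The map sending a polynomial `P` to the class of `P e^{-l|x|²/2}` in `L²`. -/
noncomputable def hermiteLp {l : ℝ} (hl : 0 < l) :
    MvPolynomial (Fin N) ℝ →ₗ[ℝ] Lp ℝ 2 (volume : Measure (EuclideanSpace ℝ (Fin N))) where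
  toFun P := (memLp_hermiteFun hl P).toLp _
  map_add' P Q := by
    rw [← MemLp.toLp_add]
    congr 1
    ext x
    simp [hermiteFun, add_mul]
  map_smul' c P := by
    rw [RingHom.id_apply, ← MemLp.toLp_const_smul]
    congr 1
    ext x
    simp [hermiteFun, mul_assoc]

theorem hermiteLp_apply {l : ℝ} (hl : 0 < l) (P : MvPolynomial (Fin N) ℝ) :
    hermiteLp hl P = (memLp_hermiteFun hl P).toLp _ := rfl

/-- Polynomials times a fixed Gaussian are dense in `L²`. -/
theorem denseRange_hermiteLp {l : ℝ} (hl : 0 < l) : DenseRange (hermiteLp (N := N) hl) := by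
  have h : (hermiteLp (N := N) hl).range.topologicalClosure = ⊤ := by
    rw [Submodule.topologicalClosure_eq_top_iff, Submodule.eq_bot_iff]
    intro f hf
    have h0 : ∀ P, ∫ x, f x * hermiteFun l P x = 0 := by
      intro P
      have := (Submodule.mem_orthogonal' _ _).1 hf _ (LinearMap.mem_range_self _ P)
      rwa [hermiteLp_apply, ← Lp.toLp_coeFn f (Lp.memLp f), inner_toLp] at this
    -- For f orthogonal to the range, f times the Gaussian vanishes; the Gaussian has no zeros.
    have hz := ae_eq_zero_of_forall_integral_cexp_inner
      ((Lp.memLp f).integrable_mul (memLp_hermiteFun hl 1))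
      (integral_cexp_inner_mul_eq_zero hl (Lp.memLp f) h0)
    rw [Lp.eq_zero_iff_ae_eq_zero]
    filter_upwards [hz] with x hx
    simpa [hermiteFun, Real.exp_ne_zero] using hx
  rw [DenseRange, ← LinearMap.coe_range, ← Submodule.dense_iff_topologicalClosure_eq_top] at *
  exact h

/-! ### Ladder operators on X -/

theorem hasWeakGradient_hermiteFun (l : ℝ) (P : MvPolynomial (Fin N) ℝ) :
    HasWeakGradient (hermiteFun l P) (fun x => WithLp.toLp 2 fun i =>
      hermiteFun l (pderiv i P) x - l * (x i * hermiteFun l P x)) where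
  locallyIntegrable := (continuous_hermiteFun l P).locallyIntegrable
  locallyIntegrable_grad := by
    refine Continuous.locallyIntegrable ?_
    have := continuous_hermiteFun l P
    have := fun i => continuous_hermiteFun l (pderiv i P)
    fun_prop
  integral_eq φ hφ hc i := by
    have hP := contDiff_hermiteFun l P
    have hφ' : Continuous fun x => fderiv ℝ φ x (EuclideanSpace.single i 1) :=
      (hφ.continuous_fderiv (by simp)).clm_apply continuous_const
    have hP' : Continuous fun x => fderiv ℝ (hermiteFun l P) x (EuclideanSpace.single i 1) :=
      (hP.continuous_fderiv (by simp)).clm_apply continuous_const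
    simp only [← fderiv_hermiteFun]
    refine integral_mul_fderiv_eq_neg_fderiv_mul_of_integrable ?_ ?_ ?_
      (fun x _ => hP.differentiable (by simp) x) (fun x _ => hφ.differentiable (by simp) x)
    · exact (hP'.mul hφ.continuous).integrable_of_hasCompactSupport hc.mul_left
    · exact (hP.continuous.mul hφ').integrable_of_hasCompactSupport
        (HasCompactSupport.mul_left (hc.fderiv_apply (𝕜 := ℝ) _))
    · exact (hP.continuous.mul hφ.continuous).integrable_of_hasCompactSupport hc.mul_left

theorem memLp_grad_hermiteFun {l : ℝ} (hl : 0 < l) (P : MvPolynomial (Fin N) ℝ) :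
    MemLp (fun x => (WithLp.toLp 2 fun i => hermiteFun l (pderiv i P) x -
      l * (x i * hermiteFun l P x) : EuclideanSpace ℝ (Fin N))) 2 := by
  rw [memLp_piLp_iff]
  intro i
  simp only [coord_mul_hermiteFun]
  exact (memLp_hermiteFun hl _).sub ((memLp_hermiteFun hl _).const_mul l)

theorem memX_hermiteFun {l : ℝ} (hl : 0 < l) (P : MvPolynomial (Fin N) ℝ) :
    MemX (hermiteFun l P) where
  memLp := memLp_hermiteFun hl P
  exists_grad := ⟨_, hasWeakGradient_hermiteFun l P, memLp_grad_hermiteFun hl P⟩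
  memLp_weight := by
    obtain ⟨C, a, hC, ha, h⟩ := abs_eval_le P
    refine (memLp_exp_norm_mul_gaussian (a + 1) (half_pos hl)).of_le_mul (c := C)
      ((continuous_norm.mul (continuous_hermiteFun l P)).aestronglyMeasurable)
      (Eventually.of_forall fun x => ?_)
    rw [hermiteFun, norm_mul, norm_mul, norm_mul, norm_norm, Real.norm_eq_abs (eval _ _),
      Real.norm_of_nonneg (Real.exp_nonneg _), Real.norm_of_nonneg (Real.exp_nonneg _), add_mul,
      Real.exp_add, ← mul_assoc, ← mul_assoc]
    refine mul_le_mul_of_nonneg_right ?_ (Real.exp_nonneg _)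
    rw [mul_comm, ← mul_assoc]
    have h2 := Real.add_one_le_exp (1 * ‖x‖)
    exact mul_le_mul (h x) (by linarith) (norm_nonneg _) (by positivity)

theorem integral_norm_sq_eq_sum {G : EuclideanSpace ℝ (Fin N) → EuclideanSpace ℝ (Fin N)}
    (hG : MemLp G 2) : ∫ x, ‖G x‖ ^ 2 = ∑ i, ∫ x, G x i ^ 2 := by
  simp only [EuclideanSpace.real_norm_sq_eq]
  exact integral_finsetSum _ fun i _ => (hG.eval_piLp i).integrable_sq

theorem MemX.memLp_coord {u : EuclideanSpace ℝ (Fin N) → ℝ} (hu : MemX u) (i : Fin N) :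
    MemLp (fun x => x i * u x) 2 := by
  refine hu.memLp_weight.of_le_mul (c := 1) ?_ (Eventually.of_forall fun x => ?_)
  · exact (EuclideanSpace.proj (𝕜 := ℝ) i).continuous.aestronglyMeasurable.mul hu.memLp.1
  · rw [one_mul, norm_mul, norm_mul, norm_norm]
    gcongr
    exact PiLp.norm_apply_le x i

theorem MemX.integral_weight_eq_sum {u : EuclideanSpace ℝ (Fin N) → ℝ} (hu : MemX u) :
    ∫ x, ‖x‖ ^ 2 * |u x| ^ 2 = ∑ i, ∫ x, (x i * u x) ^ 2 := by
  rw [← integral_finsetSum _ fun i _ => (hu.memLp_coord i).integrable_sq]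
  refine integral_congr_ae (Eventually.of_forall fun x => ?_)
  simp only [EuclideanSpace.real_norm_sq_eq, sq_abs, Finset.sum_mul, mul_pow]

theorem HasWeakGradient.integral_norm_weakGradient_sq {u : EuclideanSpace ℝ (Fin N) → ℝ}
    {G : EuclideanSpace ℝ (Fin N) → EuclideanSpace ℝ (Fin N)} (hG : HasWeakGradient u G)
    (hG2 : MemLp G 2) : ∫ x, ‖weakGradient u x‖ ^ 2 = ∑ i, ∫ x, G x i ^ 2 := by
  rw [← integral_norm_sq_eq_sum hG2]
  refine integral_congr_ae ?_
  filter_upwards [hG.weakGradient_ae_eq] with x hx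
  rw [hx]

theorem HasWeakGradient.integral_mul_hermiteFun_sub {u : EuclideanSpace ℝ (Fin N) → ℝ}
    {G : EuclideanSpace ℝ (Fin N) → EuclideanSpace ℝ (Fin N)} (hu : MemX u)
    (hG : HasWeakGradient u G) (hG2 : MemLp G 2) {l : ℝ} (hl : 0 < l) (i : Fin N)
    (P : MvPolynomial (Fin N) ℝ) :
    (∫ x, u x * hermiteFun l (pderiv i P) x) - l * ∫ x, (x i * u x) * hermiteFun l P x
      = - ∫ x, G x i * hermiteFun l P x := by
  have hP := memLp_hermiteFun hl P
  have i1 : Integrable fun x => u x * hermiteFun l (pderiv i P) x :=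
    hu.memLp.integrable_mul (memLp_hermiteFun hl _)
  have i2 : Integrable fun x => (x i * u x) * hermiteFun l P x :=
    (hu.memLp_coord i).integrable_mul hP
  have hd : ∀ x, u x * fderiv ℝ (hermiteFun l P) x (EuclideanSpace.single i 1)
      = u x * hermiteFun l (pderiv i P) x - l * ((x i * u x) * hermiteFun l P x) := by
    intro x
    rw [fderiv_hermiteFun]
    ring
  rw [← hG.integral_mul_fderiv (contDiff_hermiteFun l P) i (hu.memLp.integrable_mul hP) ?_
    ((hG2.eval_piLp i).integrable_mul hP)]
  · simp only [hd]
    rw [integral_sub i1 (i2.const_mul l), integral_const_mul]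
  · simp only [hd]
    exact i1.sub (i2.const_mul l)

section Ladder

variable {u : EuclideanSpace ℝ (Fin N) → ℝ}
  {G : EuclideanSpace ℝ (Fin N) → EuclideanSpace ℝ (Fin N)}

/-- The adjoint ∂ᵢ + l xᵢ of the raising operator acts on Pγ by differentiating P alone. -/
theorem HasWeakGradient.inner_raising (hG : HasWeakGradient u G) (hu : MemX u) (hG2 : MemLp G 2 volume)
    {l : ℝ} (hl : 0 < l) (i : Fin N) (P : MvPolynomial (Fin N) ℝ) :
    ⟪-(hG2.eval_piLp i).toLp _ + l • (hu.memLp_coord i).toLp _, hermiteLp hl P⟫_ℝ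
      = ⟪hu.memLp.toLp u, hermiteLp hl (pderiv i P)⟫_ℝ := by
  rw [inner_add_left, inner_neg_left, real_inner_smul_left]
  simp only [hermiteLp_apply, inner_toLp]
  linarith [integral_mul_hermiteFun_sub hu hG hG2 hl i P]

/-- The adjoint -∂ᵢ + l xᵢ sends Pγ to (2l xᵢP - ∂ᵢP)γ, which is why κ = 2l. -/
theorem HasWeakGradient.inner_lowering (hG : HasWeakGradient u G) (hu : MemX u) (hG2 : MemLp G 2 volume)
    {l : ℝ} (hl : 0 < l) (i : Fin N) (P : MvPolynomial (Fin N) ℝ) :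
    ⟪(hG2.eval_piLp i).toLp _ + l • (hu.memLp_coord i).toLp _, hermiteLp hl P⟫_ℝ
      = ⟪hu.memLp.toLp u, hermiteLp hl (adjDeriv (2 * l) i P)⟫_ℝ := by
  have hx : ∫ x, u x * hermiteFun l (X i * P) x = ∫ x, (x i * u x) * hermiteFun l P x := by
    refine integral_congr_ae (Eventually.of_forall fun x => ?_)
    simp only [← coord_mul_hermiteFun]
    ring
  rw [inner_add_left, real_inner_smul_left, adjDeriv_apply, map_sub, map_smul, inner_sub_right,
    real_inner_smul_right]
  simp only [hermiteLp_apply, inner_toLp, hx]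
  linarith [integral_mul_hermiteFun_sub hu hG hG2 hl i P]

end Ladder

theorem inner_hermiteLp_pderiv {l : ℝ} (hl : 0 < l) (i : Fin N) (P Q : MvPolynomial (Fin N) ℝ) :
    ⟪hermiteLp hl (pderiv i P), hermiteLp hl Q⟫_ℝ
      = ⟪hermiteLp hl P, hermiteLp hl (adjDeriv (2 * l) i Q)⟫_ℝ := by
  have hX := memX_hermiteFun hl P
  have hG := hasWeakGradient_hermiteFun l P
  rw [hermiteLp_apply hl P, ← hG.inner_lowering hX (memLp_grad_hermiteFun hl P) hl i Q]
  congr 1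
  rw [← MemLp.toLp_const_smul, ← MemLp.toLp_add, hermiteLp_apply, MemLp.toLp_eq_toLp_iff]
  exact Eventually.of_forall fun x => by simp

/-! ### The inequality at each scale and its optimisation -/

/-- The scale-dependent Heisenberg–Poincaré inequality. -/
theorem MemX.poincare {u : EuclideanSpace ℝ (Fin N) → ℝ} (hu : MemX u) {l : ℝ} (hl : 0 < l)
    {c : ℝ} (hc : ⟪hu.memLp.toLp u - c • hermiteLp hl 1, hermiteLp hl 1⟫_ℝ = 0) :
    l * (N * (∫ x, |u x| ^ 2) + 2 * ‖hu.memLp.toLp u - c • hermiteLp hl 1‖ ^ 2)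
      ≤ (∫ x, ‖weakGradient u x‖ ^ 2) + l ^ 2 * ∫ x, ‖x‖ ^ 2 * |u x| ^ 2 := by
  obtain ⟨G, hG, hG2⟩ := hu.exists_grad
  have h1 := Heisenberg.poincare (by positivity : 0 < 2 * l) (inner_hermiteLp_pderiv hl)
    (denseRange_hermiteLp hl) (fun i P => hG.inner_lowering hu hG2 hl i P) hc
  -- The raised and lowered norms have opposite cross terms, so the commutation relation forces
  -- 2l⟨∂ᵢu, xᵢu⟩ = -l‖u‖².
  have h2 : ∀ i, ‖(hG2.eval_piLp i).toLp _ + l • (hu.memLp_coord i).toLp _‖ ^ 2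
      = (∫ x, G x i ^ 2) + l ^ 2 * (∫ x, (x i * u x) ^ 2) - l * ∫ x, |u x| ^ 2 := by
    intro i
    have h3 := norm_sq_eq_norm_sq_add (inner_hermiteLp_pderiv hl) (denseRange_hermiteLp hl)
      (fun P => hG.inner_lowering hu hG2 hl i P) (fun P => hG.inner_raising hu hG2 hl i P)
    simp only [norm_add_sq_real, norm_neg, inner_neg_left, norm_smul, mul_pow, norm_toLp_sq,
      Real.norm_eq_abs, sq_abs] at h3 ⊢
    linarith
  simp only [h2, Finset.sum_sub_distrib, Finset.sum_add_distrib, ← Finset.mul_sum,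
    Finset.sum_const, Finset.card_univ, Fintype.card_fin, nsmul_eq_mul,
    ← hG.integral_norm_weakGradient_sq hG2, ← hu.integral_weight_eq_sum] at h1
  linarith

theorem sq_le_four_mul_of_forall {A B K : ℝ} (hB : 0 ≤ B) (hK : 0 ≤ K)
    (h : ∀ l : ℝ, 0 < l → l * K ≤ A + l ^ 2 * B) : K ^ 2 ≤ 4 * (A * B) := by
  rcases hK.eq_or_lt with rfl | hK
  · have hA : 0 ≤ A := by
      by_contra hA
      push Not at hA
      have h1 := h 1 one_pos
      rcases hB.eq_or_lt with rfl | hB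
      · linarith
      · have hr : 0 < -A / (2 * B) := div_pos (by linarith) (by linarith)
        -- For this l one has A + l²B = A/2 < 0, a contradiction.
        have h2 := h (Real.sqrt (-A / (2 * B))) (Real.sqrt_pos.2 hr)
        rw [Real.sq_sqrt hr.le] at h2
        have : -A / (2 * B) * B = -A / 2 := by field_simp
        linarith
    nlinarith [mul_nonneg hA hB]
  rcases hB.eq_or_lt with rfl | hB
  · have h1 := h ((|A| + 1) / K) (by positivity)
    rw [div_mul_cancel₀ _ hK.ne'] at h1
    linarith [le_abs_self A]
  · have h1 := h (K / (2 * B)) (by positivity)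
    have e1 : K / (2 * B) * K = 2 * (K ^ 2 / (4 * B)) := by field_simp; ring
    have e2 : (K / (2 * B)) ^ 2 * B = K ^ 2 / (4 * B) := by field_simp; ring
    rw [e1, e2] at h1
    have h2 : K ^ 2 / (4 * B) ≤ A := by linarith
    rw [div_le_iff₀ (by positivity)] at h2
    linarith

/-! ### Distances to the Gaussians and the two inequalities -/

theorem l2norm_eq_norm_toLp {f : EuclideanSpace ℝ (Fin N) → ℝ} (hf : MemLp f 2) :
    l2norm f = ‖hf.toLp f‖ := by
  rw [l2norm, Real.sqrt_eq_iff_eq_sq (by positivity) (norm_nonneg _), norm_toLp_sq]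
  simp only [sq_abs]

theorem l2norm_sq (f : EuclideanSpace ℝ (Fin N) → ℝ) : l2norm f ^ 2 = ∫ x, |f x| ^ 2 :=
  Real.sq_sqrt (by positivity)

theorem mem_gaussians_iff {v : EuclideanSpace ℝ (Fin N) → ℝ} :
    v ∈ gaussians N ↔ ∃ c l : ℝ, 0 < l ∧ v = fun x => c * hermiteFun l 1 x := by
  constructor
  · rintro ⟨c, α, hα, rfl⟩
    refine ⟨c, 2 * α, by positivity, ?_⟩
    simp [hermiteFun]
  · rintro ⟨c, l, hl, rfl⟩
    refine ⟨c, l / 2, by positivity, ?_⟩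
    simp [hermiteFun]

theorem dist₁_le {u v : EuclideanSpace ℝ (Fin N) → ℝ} (hv : v ∈ gaussians N) :
    dist₁ u ≤ l2norm (fun x => u x - v x) :=
  csInf_le ⟨0, by rintro _ ⟨_, _, rfl⟩; exact Real.sqrt_nonneg _⟩ ⟨v, hv, rfl⟩

theorem dist₂_le {u v : EuclideanSpace ℝ (Fin N) → ℝ} (hv : v ∈ gaussians N)
    (h : l2norm u = l2norm v) : dist₂ u ≤ l2norm (fun x => u x - v x) :=
  csInf_le ⟨0, by rintro _ ⟨_, _, _, rfl⟩; exact Real.sqrt_nonneg _⟩ ⟨v, hv, h, rfl⟩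

theorem dist₁_nonneg (u : EuclideanSpace ℝ (Fin N) → ℝ) : 0 ≤ dist₁ u :=
  Real.sInf_nonneg (by rintro _ ⟨_, _, rfl⟩; exact Real.sqrt_nonneg _)

theorem dist₂_nonneg (u : EuclideanSpace ℝ (Fin N) → ℝ) : 0 ≤ dist₂ u :=
  Real.sInf_nonneg (by rintro _ ⟨_, _, _, rfl⟩; exact Real.sqrt_nonneg _)

theorem toLp_const_mul_hermiteFun {l : ℝ} (hl : 0 < l) (c : ℝ) (P : MvPolynomial (Fin N) ℝ) :
    ((memLp_hermiteFun hl P).const_mul c).toLp (fun x => c * hermiteFun l P x)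
      = c • hermiteLp hl P := rfl

theorem hermiteLp_one_ne_zero {l : ℝ} (hl : 0 < l) : hermiteLp (N := N) hl 1 ≠ 0 := by
  intro h
  have h0 : hermiteFun l (1 : MvPolynomial (Fin N) ℝ) =ᵐ[volume] 0 := by
    refine (memLp_hermiteFun hl 1).coeFn_toLp.symm.trans ?_
    rw [← hermiteLp_apply hl, h]
    exact Lp.coeFn_zero _ _ _
  have := (continuous_hermiteFun l (1 : MvPolynomial (Fin N) ℝ)).ae_eq_iff_eq volume
    continuous_zero |>.1 h0
  simpa [hermiteFun, Real.exp_ne_zero] using congrFun this 0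

section Projection

variable {H : Type*} [NormedAddCommGroup H] [InnerProductSpace ℝ H]

theorem exists_inner_sub_smul_eq_zero (U : H) {γ : H} (hγ : γ ≠ 0) :
    ∃ c : ℝ, ⟪U - c • γ, γ⟫_ℝ = 0 := by
  refine ⟨⟪U, γ⟫_ℝ / ⟪γ, γ⟫_ℝ, ?_⟩
  rw [inner_sub_left, real_inner_smul_left, div_mul_cancel₀ _ (inner_self_ne_zero.2 hγ), sub_self]

/-- Give b the sign of c and the size that makes the norms equal. Then |c| ≤ |b|, so bc ≥ c² and ‖U
- bγ‖² = 2‖U‖² - 2bc‖γ‖² ≤ 2(‖U‖² - c²‖γ‖²). -/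
theorem exists_norm_smul_eq {U γ : H} (hγ : γ ≠ 0) {c : ℝ} (hc : ⟪U - c • γ, γ⟫_ℝ = 0) :
    ∃ b : ℝ, ‖b • γ‖ = ‖U‖ ∧ ‖U - b • γ‖ ^ 2 ≤ 2 * ‖U - c • γ‖ ^ 2 := by
  have hγ' : 0 < ‖γ‖ := norm_pos_iff.2 hγ
  rw [inner_sub_left, real_inner_smul_left, real_inner_self_eq_norm_sq, sub_eq_zero] at hc
  have key : ∀ b : ℝ, ‖U - b • γ‖ ^ 2 = ‖U‖ ^ 2 - 2 * (b * c) * ‖γ‖ ^ 2 + b ^ 2 * ‖γ‖ ^ 2 := by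
    intro b
    rw [norm_sub_sq_real, real_inner_smul_right, hc, norm_smul, mul_pow, Real.norm_eq_abs, sq_abs]
    ring
  obtain ⟨b, hb, hbc⟩ : ∃ b : ℝ, |b| = ‖U‖ / ‖γ‖ ∧ b * c = |b| * |c| := by
    have h0 : 0 ≤ ‖U‖ / ‖γ‖ := by positivity
    rcases le_total 0 c with h | h
    · exact ⟨‖U‖ / ‖γ‖, abs_of_nonneg h0, by rw [abs_of_nonneg h0, abs_of_nonneg h]⟩
    · exact ⟨-(‖U‖ / ‖γ‖), by rw [abs_neg, abs_of_nonneg h0],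
        by rw [abs_neg, abs_of_nonneg h0, abs_of_nonpos h]; ring⟩
  have hbU : |b| * ‖γ‖ = ‖U‖ := by rw [hb, div_mul_cancel₀ _ hγ'.ne']
  refine ⟨b, by rw [norm_smul, Real.norm_eq_abs, hbU], ?_⟩
  have hbU2 : b ^ 2 * ‖γ‖ ^ 2 = ‖U‖ ^ 2 := by rw [← hbU, mul_pow, sq_abs]
  have hcb : |c| ≤ |b| := by
    rw [← sq_le_sq]
    have : 0 ≤ ‖U - c • γ‖ ^ 2 := sq_nonneg _
    rw [key] at this
    exact le_of_mul_le_mul_right (by nlinarith) (by positivity : 0 < ‖γ‖ ^ 2)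
  have hcc : c ^ 2 ≤ b * c := by
    rw [hbc, ← sq_abs]
    nlinarith [abs_nonneg c]
  rw [key, key]
  nlinarith [mul_le_mul_of_nonneg_right hcc (sq_nonneg ‖γ‖)]

end Projection

theorem MemX.deficit_ge_dist₁ {u : EuclideanSpace ℝ (Fin N) → ℝ} (hu : MemX u) :
    N * (∫ x, |u x| ^ 2) * dist₁ u ^ 2 + dist₁ u ^ 4 ≤ deficit u := by
  have hM : 0 ≤ ∫ x, |u x| ^ 2 := by positivity
  have h := sq_le_four_mul_of_forall (A := ∫ x, ‖weakGradient u x‖ ^ 2)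
    (B := ∫ x, ‖x‖ ^ 2 * |u x| ^ 2) (K := N * (∫ x, |u x| ^ 2) + 2 * dist₁ u ^ 2)
    (by positivity) (by positivity) ?_
  · rw [deficit]
    linarith
  · intro l hl
    obtain ⟨c, hc⟩ := exists_inner_sub_smul_eq_zero (hu.memLp.toLp u) (hermiteLp_one_ne_zero hl)
    refine le_trans ?_ (hu.poincare hl hc)
    have hle := dist₁_le (u := u) (mem_gaussians_iff.2 ⟨c, l, hl, rfl⟩)
    have hle' := hle.trans_eq
      (l2norm_eq_norm_toLp (hu.memLp.sub ((memLp_hermiteFun hl 1).const_mul c)))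
    gcongr
    · exact dist₁_nonneg u
    · exact hle'

theorem MemX.deficit_ge_dist₂ {u : EuclideanSpace ℝ (Fin N) → ℝ} (hu : MemX u) :
    N / 2 * (∫ x, |u x| ^ 2) * dist₂ u ^ 2 + 1 / 4 * dist₂ u ^ 4 ≤ deficit u := by
  have hM : 0 ≤ ∫ x, |u x| ^ 2 := by positivity
  have h := sq_le_four_mul_of_forall (A := ∫ x, ‖weakGradient u x‖ ^ 2)
    (B := ∫ x, ‖x‖ ^ 2 * |u x| ^ 2) (K := N * (∫ x, |u x| ^ 2) + dist₂ u ^ 2)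
    (by positivity) (by positivity) ?_
  · rw [deficit]
    linarith
  · intro l hl
    obtain ⟨c, hc⟩ := exists_inner_sub_smul_eq_zero (hu.memLp.toLp u) (hermiteLp_one_ne_zero hl)
    obtain ⟨b, hb, hbc⟩ := exists_norm_smul_eq (hermiteLp_one_ne_zero hl) hc
    refine le_trans ?_ (hu.poincare hl hc)
    have hbm := (memLp_hermiteFun hl (1 : MvPolynomial (Fin N) ℝ)).const_mul b
    have hle := dist₂_le (u := u) (mem_gaussians_iff.2 ⟨b, l, hl, rfl⟩)
      (by rw [l2norm_eq_norm_toLp hu.memLp, l2norm_eq_norm_toLp hbm]; exact hb.symm)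
    have hle' := hle.trans_eq (l2norm_eq_norm_toLp (hu.memLp.sub hbm))
    gcongr
    exact (pow_le_pow_left₀ (dist₂_nonneg u) hle' 2).trans hbc

/-! ### The extremal function xⱼe^{-|x|²/2} -/

/-- Adjointness applied to 1 = ∂ⱼxⱼ; in this way all moments below are found without evaluating a
Gaussian integral. -/
theorem norm_hermiteLp_one_sq {l : ℝ} (hl : 0 < l) (j : Fin N) :
    ‖hermiteLp (N := N) hl 1‖ ^ 2 = 2 * l * ‖hermiteLp hl (X j)‖ ^ 2 := by
  have h := inner_hermiteLp_pderiv hl j (X j) 1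
  rw [pderiv_X_self, adjDeriv_apply, mul_one, pderiv_one, sub_zero, map_smul,
    real_inner_smul_right] at h
  rwa [real_inner_self_eq_norm_sq, real_inner_self_eq_norm_sq] at h

theorem norm_hermiteLp_pderiv_X_sq {l : ℝ} (hl : 0 < l) (i j : Fin N) :
    ‖hermiteLp hl (pderiv i (X j))‖ ^ 2
      = (if i = j then 2 * l else 0) * ‖hermiteLp hl (X j)‖ ^ 2 := by
  split_ifs with h
  · subst h
    rw [pderiv_X_self, norm_hermiteLp_one_sq hl i]
  · rw [pderiv_X_of_ne (Ne.symm h)]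
    simp

theorem norm_hermiteLp_adjDeriv_X_sq {l : ℝ} (hl : 0 < l) (i j : Fin N) :
    ‖hermiteLp hl (adjDeriv (2 * l) i (X j))‖ ^ 2
      = ((if i = j then 2 * l else 0) + 2 * l) * ‖hermiteLp hl (X j)‖ ^ 2 := by
  rw [← real_inner_self_eq_norm_sq, ← inner_hermiteLp_pderiv, pderiv_adjDeriv, if_pos rfl, map_add,
    inner_add_left, map_smul, real_inner_smul_left, real_inner_comm, ← inner_hermiteLp_pderiv,
    real_inner_self_eq_norm_sq, real_inner_self_eq_norm_sq, norm_hermiteLp_pderiv_X_sq]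
  ring

theorem inner_hermiteLp_pderiv_X_adjDeriv_X {l : ℝ} (hl : 0 < l) (i j : Fin N) :
    ⟪hermiteLp hl (pderiv i (X j)), hermiteLp hl (adjDeriv (2 * l) i (X j))⟫_ℝ = 0 := by
  rw [← inner_hermiteLp_pderiv, pderiv_X, Pi.single_apply]
  split_ifs <;> simp

/-- At l = 1 the position is half the sum of lowering and raising, and the two images of xⱼ are
orthogonal. The gradient is half the difference, hence has the same norm. -/
theorem norm_hermiteLp_X_mul_X_sq (i j : Fin N) :
    ‖hermiteLp one_pos (X i * X j)‖ ^ 2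
      = ((if i = j then 1 else 0) + 1 / 2) * ‖hermiteLp one_pos (X j)‖ ^ 2 := by
  have h : (2 : ℝ) • hermiteLp one_pos (X i * X j) = hermiteLp one_pos (pderiv i (X j))
      + hermiteLp one_pos (adjDeriv (2 * 1) i (X j)) := by
    rw [adjDeriv_apply, ← map_add, ← map_smul, mul_one, add_sub_cancel]
  have h2 := congrArg (fun v => ‖v‖ ^ 2) h
  rw [norm_smul, mul_pow, norm_add_sq_real, inner_hermiteLp_pderiv_X_adjDeriv_X,
    norm_hermiteLp_pderiv_X_sq, norm_hermiteLp_adjDeriv_X_sq] at h2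
  simp only [Real.norm_ofNat] at h2
  split_ifs at h2 ⊢ <;> linarith

theorem norm_hermiteLp_pderiv_X_sub_sq (i j : Fin N) :
    ‖hermiteLp one_pos (pderiv i (X j) - X i * X j)‖ ^ 2
      = ((if i = j then 1 else 0) + 1 / 2) * ‖hermiteLp one_pos (X j)‖ ^ 2 := by
  have h : (2 : ℝ) • hermiteLp one_pos (pderiv i (X j) - X i * X j)
      = hermiteLp one_pos (pderiv i (X j))
      - hermiteLp one_pos (adjDeriv (2 * 1) i (X j)) := by
    rw [adjDeriv_apply, ← map_sub, ← map_smul, mul_one]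
    congr 1
    module
  have h2 := congrArg (fun v => ‖v‖ ^ 2) h
  rw [norm_smul, mul_pow, norm_sub_sq_real, inner_hermiteLp_pderiv_X_adjDeriv_X,
    norm_hermiteLp_pderiv_X_sq, norm_hermiteLp_adjDeriv_X_sq] at h2
  simp only [Real.norm_ofNat] at h2
  split_ifs at h2 ⊢ <;> linarith

theorem integral_hermiteFun_sq {l : ℝ} (hl : 0 < l) (P : MvPolynomial (Fin N) ℝ) :
    ∫ x, hermiteFun l P x ^ 2 = ‖hermiteLp hl P‖ ^ 2 :=
  (norm_toLp_sq (memLp_hermiteFun hl P)).symm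

/-- The deficit of the first excited state `xⱼ e^{-|x|²/2}` of the harmonic oscillator. -/
theorem deficit_hermiteFun_X (j : Fin N) :
    deficit (hermiteFun 1 (X j)) = (N + 1) * (∫ x, |hermiteFun 1 (X j) x| ^ 2) ^ 2 := by
  have hX := memX_hermiteFun one_pos (X j : MvPolynomial (Fin N) ℝ)
  have hG := (hasWeakGradient_hermiteFun 1 (X j)).integral_norm_weakGradient_sq
    (memLp_grad_hermiteFun one_pos (X j : MvPolynomial (Fin N) ℝ))
  have hsum : ∑ i : Fin N, ((if i = j then 1 else 0) + 1 / 2) * ‖hermiteLp one_pos (X j)‖ ^ 2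
      = (1 + (N : ℝ) / 2) * ‖hermiteLp one_pos (X j)‖ ^ 2 := by
    rw [← Finset.sum_mul, Finset.sum_add_distrib]
    simp [div_eq_mul_inv]
  have hA : ∫ x, ‖weakGradient (hermiteFun 1 (X j)) x‖ ^ 2
      = (1 + (N : ℝ) / 2) * ‖hermiteLp one_pos (X j)‖ ^ 2 := by
    rw [hG, ← hsum]
    refine Finset.sum_congr rfl fun i _ => ?_
    rw [← norm_hermiteLp_pderiv_X_sub_sq, ← integral_hermiteFun_sq]
    refine integral_congr_ae (Eventually.of_forall fun x => ?_)
    simp only [hermiteFun, map_sub, map_mul, eval_X]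
    ring
  have hB : ∫ x, ‖x‖ ^ 2 * |hermiteFun 1 (X j) x| ^ 2
      = (1 + (N : ℝ) / 2) * ‖hermiteLp one_pos (X j)‖ ^ 2 := by
    rw [hX.integral_weight_eq_sum, ← hsum]
    refine Finset.sum_congr rfl fun i _ => ?_
    simp only [coord_mul_hermiteFun]
    rw [← norm_hermiteLp_X_mul_X_sq, ← integral_hermiteFun_sq]
  have hM : ∫ x, |hermiteFun 1 (X j) x| ^ 2 = ‖hermiteLp one_pos (X j)‖ ^ 2 := by
    simp only [sq_abs]
    exact integral_hermiteFun_sq one_pos (X j)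
  rw [deficit, hA, hB, hM]
  ring

/-- The integrand is odd, whatever the two widths. -/
theorem inner_hermiteLp_X_one {l m : ℝ} (hl : 0 < l) (hm : 0 < m) (j : Fin N) :
    ⟪hermiteLp hl (X j), hermiteLp hm 1⟫_ℝ = 0 := by
  rw [hermiteLp_apply, hermiteLp_apply, inner_toLp]
  have h := integral_neg_eq_self
    (fun x : EuclideanSpace ℝ (Fin N) => hermiteFun l (X j) x * hermiteFun m 1 x) volume
  have h' : ∀ x : EuclideanSpace ℝ (Fin N), hermiteFun l (X j) (-x) * hermiteFun m 1 (-x)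
      = - (hermiteFun l (X j) x * hermiteFun m 1 x) := by
    intro x
    simp [hermiteFun]
  simp only [h', integral_neg] at h
  linarith

theorem l2norm_hermiteFun_X_sub_sq (j : Fin N) {l : ℝ} (hl : 0 < l) (c : ℝ) :
    l2norm (fun x => hermiteFun 1 (X j) x - c * hermiteFun l 1 x) ^ 2
      = l2norm (hermiteFun 1 (X j)) ^ 2 + l2norm (fun x => c * hermiteFun (N := N) l 1 x) ^ 2 := by
  have h1 := memLp_hermiteFun one_pos (X j : MvPolynomial (Fin N) ℝ)
  have h2 := (memLp_hermiteFun hl (1 : MvPolynomial (Fin N) ℝ)).const_mul c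
  have h3 : ⟪h1.toLp _, h2.toLp _⟫_ℝ = 0 := by
    rw [toLp_const_mul_hermiteFun hl, real_inner_smul_right, ← hermiteLp_apply one_pos,
      inner_hermiteLp_X_one, mul_zero]
  rw [l2norm_eq_norm_toLp h1, l2norm_eq_norm_toLp h2]
  have h4 := congrArg (· ^ 2) (l2norm_eq_norm_toLp (h1.sub h2))
  refine h4.trans ?_
  simp only
  rw [MemLp.toLp_sub h1 h2, norm_sub_sq_real, h3]
  ring

theorem dist₁_hermiteFun_X (j : Fin N) :
    dist₁ (hermiteFun 1 (X j)) = l2norm (hermiteFun 1 (X j)) := by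
  refine le_antisymm ?_ (le_csInf ⟨_, _, mem_gaussians_iff.2 ⟨0, 1, one_pos, rfl⟩, rfl⟩ ?_)
  · simpa using dist₁_le (u := hermiteFun 1 (X j)) (mem_gaussians_iff.2 ⟨0, 1, one_pos, rfl⟩)
  · rintro _ ⟨v, hv, rfl⟩
    obtain ⟨c, l, hl, rfl⟩ := mem_gaussians_iff.1 hv
    refine le_of_sq_le_sq ?_ (Real.sqrt_nonneg _)
    rw [l2norm_hermiteFun_X_sub_sq j hl]
    linarith [sq_nonneg (l2norm fun x => c * hermiteFun (N := N) l 1 x)]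

theorem dist₂_hermiteFun_X_sq (j : Fin N) :
    dist₂ (hermiteFun 1 (X j)) ^ 2 = 2 * l2norm (hermiteFun 1 (X j)) ^ 2 := by
  have hM : 0 ≤ l2norm (hermiteFun 1 (X j)) := Real.sqrt_nonneg _
  have key : ∀ v ∈ gaussians N, l2norm (hermiteFun 1 (X j)) = l2norm v →
      l2norm (fun x => hermiteFun 1 (X j) x - v x)
        = Real.sqrt (2 * l2norm (hermiteFun 1 (X j)) ^ 2) := by
    intro v hv h
    obtain ⟨c, l, hl, rfl⟩ := mem_gaussians_iff.1 hv
    refine ((Real.sqrt_eq_iff_eq_sq (by positivity) (Real.sqrt_nonneg _)).2 ?_).symm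
    rw [← l2norm, l2norm_hermiteFun_X_sub_sq j hl, ← h]
    ring
  -- All admissible Gaussians are equally far away, but one must be exhibited, since the infimum of
  -- the empty set would be 0.
  obtain ⟨b, hb, -⟩ := exists_norm_smul_eq (U := hermiteLp one_pos (X j))
    (hermiteLp_one_ne_zero one_pos) (c := 0)
    (by rw [zero_smul, sub_zero, inner_hermiteLp_X_one])
  have hv : (fun x => b * hermiteFun 1 1 x) ∈ gaussians N :=
    mem_gaussians_iff.2 ⟨b, 1, one_pos, rfl⟩
  have hvn : l2norm (hermiteFun 1 (X j)) = l2norm (fun x => b * hermiteFun (N := N) 1 1 x) := by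
    rw [l2norm_eq_norm_toLp (memLp_hermiteFun one_pos _),
      l2norm_eq_norm_toLp ((memLp_hermiteFun one_pos _).const_mul b)]
    exact hb.symm
  have hd : dist₂ (hermiteFun 1 (X j)) = Real.sqrt (2 * l2norm (hermiteFun 1 (X j)) ^ 2) := by
    refine le_antisymm ((dist₂_le hv hvn).trans_eq (key _ hv hvn)) (le_csInf ⟨_, _, hv, hvn, rfl⟩ ?_)
    rintro _ ⟨v, hv, h, rfl⟩
    exact (key v hv h).ge
  rw [hd, Real.sq_sqrt (by positivity)]

theorem l2norm_hermiteFun_X_pos (j : Fin N) : 0 < l2norm (hermiteFun 1 (X j)) := by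
  have h := norm_hermiteLp_one_sq one_pos j
  have h1 : 0 < ‖hermiteLp (N := N) one_pos 1‖ ^ 2 := by
    have := norm_pos_iff.2 (hermiteLp_one_ne_zero (N := N) one_pos)
    positivity
  rw [l2norm_eq_norm_toLp (memLp_hermiteFun one_pos _), ← hermiteLp_apply one_pos]
  refine norm_pos_iff.2 fun h0 => ?_
  rw [h0] at h
  simp only [norm_zero] at h
  linarith

end Heisenberg

theorem theorem1p3 (N : ℕ) (hN : 1 ≤ N) :
    -- the first inequality
    (∀ u : EuclideanSpace ℝ (Fin N) → ℝ, Heisenberg.MemX u →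
      Heisenberg.deficit u ≥
        N * (∫ x, |u x| ^ 2) * Heisenberg.dist₁ u ^ 2 + Heisenberg.dist₁ u ^ 4) ∧
    -- the second inequality
    (∀ u : EuclideanSpace ℝ (Fin N) → ℝ, Heisenberg.MemX u →
      Heisenberg.deficit u ≥
        N / 2 * (∫ x, |u x| ^ 2) * Heisenberg.dist₂ u ^ 2 + 1 / 4 * Heisenberg.dist₂ u ^ 4) ∧
    -- the first inequality is sharp: neither of its constants can be increased
    (∀ C : ℝ, (∀ u : EuclideanSpace ℝ (Fin N) → ℝ, Heisenberg.MemX u →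
      Heisenberg.deficit u ≥
        C * (∫ x, |u x| ^ 2) * Heisenberg.dist₁ u ^ 2 + Heisenberg.dist₁ u ^ 4) → C ≤ N) ∧
    (∀ C : ℝ, (∀ u : EuclideanSpace ℝ (Fin N) → ℝ, Heisenberg.MemX u →
      Heisenberg.deficit u ≥
        N * (∫ x, |u x| ^ 2) * Heisenberg.dist₁ u ^ 2 + C * Heisenberg.dist₁ u ^ 4) → C ≤ 1) ∧
    -- the second inequality is sharp: neither of its constants can be increased
    (∀ C : ℝ, (∀ u : EuclideanSpace ℝ (Fin N) → ℝ, Heisenberg.MemX u →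
      Heisenberg.deficit u ≥
        C * (∫ x, |u x| ^ 2) * Heisenberg.dist₂ u ^ 2 + 1 / 4 * Heisenberg.dist₂ u ^ 4) →
      C ≤ N / 2) ∧
    (∀ C : ℝ, (∀ u : EuclideanSpace ℝ (Fin N) → ℝ, Heisenberg.MemX u →
      Heisenberg.deficit u ≥
        N / 2 * (∫ x, |u x| ^ 2) * Heisenberg.dist₂ u ^ 2 + C * Heisenberg.dist₂ u ^ 4) →
      C ≤ 1 / 4) ∧
    -- equality in the first inequality is attained by some function at positive distance from `E`
    (∃ u : EuclideanSpace ℝ (Fin N) → ℝ, Heisenberg.MemX u ∧ 0 < Heisenberg.dist₁ u ∧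
      Heisenberg.deficit u =
        N * (∫ x, |u x| ^ 2) * Heisenberg.dist₁ u ^ 2 + Heisenberg.dist₁ u ^ 4) ∧
    -- equality in the second inequality is attained by some function at positive distance from `E`
    (∃ u : EuclideanSpace ℝ (Fin N) → ℝ, Heisenberg.MemX u ∧ 0 < Heisenberg.dist₁ u ∧
      0 < Heisenberg.dist₂ u ∧
      Heisenberg.deficit u =
        N / 2 * (∫ x, |u x| ^ 2) * Heisenberg.dist₂ u ^ 2 + 1 / 4 * Heisenberg.dist₂ u ^ 4) := by
  obtain ⟨j⟩ : Nonempty (Fin N) := ⟨⟨0, hN⟩⟩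
  set f : EuclideanSpace ℝ (Fin N) → ℝ := Heisenberg.hermiteFun 1 (MvPolynomial.X j)
  have hf : Heisenberg.MemX f := Heisenberg.memX_hermiteFun one_pos _
  have hpos := Heisenberg.l2norm_hermiteFun_X_pos j
  have hM : 0 < ∫ x, |f x| ^ 2 := by
    rw [← Heisenberg.l2norm_sq]
    exact pow_pos hpos 2
  have hdef : Heisenberg.deficit f = (N + 1) * (∫ x, |f x| ^ 2) ^ 2 :=
    Heisenberg.deficit_hermiteFun_X j
  have h1 : Heisenberg.dist₁ f ^ 2 = ∫ x, |f x| ^ 2 := by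
    rw [Heisenberg.dist₁_hermiteFun_X, Heisenberg.l2norm_sq]
  have h2 : Heisenberg.dist₂ f ^ 2 = 2 * ∫ x, |f x| ^ 2 := by
    rw [Heisenberg.dist₂_hermiteFun_X_sq, Heisenberg.l2norm_sq]
  have h1' : Heisenberg.dist₁ f ^ 4 = (∫ x, |f x| ^ 2) ^ 2 := by rw [← h1]; ring
  have h2' : Heisenberg.dist₂ f ^ 4 = 4 * (∫ x, |f x| ^ 2) ^ 2 := by
    rw [show Heisenberg.dist₂ f ^ 4 = (Heisenberg.dist₂ f ^ 2) ^ 2 by ring, h2]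
    ring
  have hd1 : 0 < Heisenberg.dist₁ f := by
    rw [Heisenberg.dist₁_hermiteFun_X]
    exact hpos
  have hd2 : 0 < Heisenberg.dist₂ f :=
    lt_of_le_of_ne (Heisenberg.dist₂_nonneg f) fun h => by
      rw [← h] at h2
      linarith
  have hM2 : 0 < (∫ x, |f x| ^ 2) ^ 2 := pow_pos hM 2
  -- For f every term is a multiple of M², so the remaining claims compare coefficients: N + 1
  -- against C + 1, N + C, 2C + 1 and N + 4C, with equality at the stated constants.
  refine ⟨fun u hu => hu.deficit_ge_dist₁, fun u hu => hu.deficit_ge_dist₂, fun C h => ?_,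
    fun C h => ?_, fun C h => ?_, fun C h => ?_, ⟨f, hf, hd1, ?_⟩, ⟨f, hf, hd1, hd2, ?_⟩⟩
  · have := h f hf
    rw [hdef, h1, h1'] at this
    exact le_of_mul_le_mul_right (by linarith) hM2
  · have := h f hf
    rw [hdef, h1, h1'] at this
    exact le_of_mul_le_mul_right (by linarith) hM2
  · have := h f hf
    rw [hdef, h2, h2'] at this
    exact le_of_mul_le_mul_right (by linarith) hM2
  · have := h f hf
    rw [hdef, h2, h2'] at this
    exact le_of_mul_le_mul_right (by linarith) hM2
  · rw [hdef, h1, h1']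
    ring
  · rw [hdef, h2, h2']
    ring
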